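/- For a finite simple graph $G$ on $n$ vertices with adjacency eigenvalues $\lambda_1\ge\cdots\ge\lambda_n$ (with multiplicity), let $$ER(G)=\sum_{i=1}^n\frac{1}{n-\lambda_i}$$ be its resolvent energy. A finite graph is called bicyclic if it is connected and its number of edges is one more than its number of vertices. Let $\theta(2,2,1)$ be the union of three internally disjoint paths of lengths $2,2,1$ with common end vertices, and, for $n\ge 5$, let $Y_n$ be the graph on $n$ vertices obtained from $\theta(2,2,1)$ by attaching $n-4$ pendent vertices to one of its vertices of degree $3$. Let $G$ be a bicyclic graph on $n\ge 5$ vertices. Then $ER(G)\le ER(Y_n)$, with equality if and only if $G\cong Y_n$. -/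

import Mathlib

/-- The resolvent energy `∑ 1 / (n - λᵢ)` of a finite simple graph with `n` vertices, where the
`λᵢ` are the eigenvalues of its adjacency matrix, listed with multiplicity. -/
noncomputable def SimpleGraph.resolventEnergy {V : Type*} [Fintype V] (G : SimpleGraph V) : ℝ := by
  classical
  exact ∑ i : V, 1 / ((Fintype.card V : ℝ) - (G.isHermitian_adjMatrix ℝ).eigenvalues i)

/-- A finite graph is bicyclic if it is connected and has one edge more than it has vertices. -/
def SimpleGraph.IsBicyclic {V : Type*} [Fintype V] (G : SimpleGraph V) : Prop :=
  G.Connected ∧ G.edgeSet.ncard = Fintype.card V + 1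

/-- The graph `θ(2, 2, 1)`: the union of the three internally disjoint paths
`0 - 2 - 1`, `0 - 3 - 1` and `0 - 1`. Its vertices of degree 3 are `0` and `1`. -/
def theta221 : SimpleGraph (Fin 4) :=
  SimpleGraph.fromEdgeSet {s(0, 2), s(2, 1), s(0, 3), s(3, 1), s(0, 1)}

/-- The graph obtained from `G` by attaching `k` new pendent vertices to the vertex `v`. -/
def SimpleGraph.attachPendent {V : Type*} (G : SimpleGraph V) (v : V) (k : ℕ) :
    SimpleGraph (V ⊕ Fin k) where
  Adj
    | .inl a, .inl b => G.Adj a b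
    | .inl a, .inr _ => a = v
    | .inr _, .inl b => b = v
    | .inr _, .inr _ => False
  symm := ⟨by
    rintro (a | a) (b | b) h
    · exact G.adj_symm h
    · exact h
    · exact h
    · exact h⟩
  loopless := ⟨by
    rintro (a | a) h
    · exact G.loopless.irrefl a h
    · exact h⟩

/-- The graph `Y_n` (for `n ≥ 4`): `θ(2, 2, 1)` with `n - 4` pendent vertices attached to one of
its vertices of degree 3. It has `4 + (n - 4) = n` vertices. -/
def graphY (n : ℕ) : SimpleGraph (Fin 4 ⊕ Fin (n - 4)) :=
  theta221.attachPendent 0 (n - 4)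

open Finset

/-! Let `w` be a monic quintic with `w 0 = 0`. Since `(w n - w x) / (n - x)` is a quartic polynomial
in `x`, summing over the eigenvalues `λᵢ` writes `ER(G) * w n` as a combination of the first four
spectral moments plus `∑ w λᵢ / (n - λᵢ)` (`resolventEnergy_mul_quintic`). The moments count closed
walks, so they depend only on the degrees and on the numbers of triangles and 4-cycles. All
eigenvalues lie below `n`; hence a quintic that is nonpositive on the spectrum bounds `ER(G)` from
above, and one that vanishes on it gives the exact value.

For `Y_n` the quintic `x^5 - (n+1) x^3 - 4 x^2 + (2n-8) x` kills every eigenvalue. Its value at `n`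
is `n (n^4 - n^3 - n^2 - 2n - 8)`, the factor in all the comparisons, and the moments give `2n^3 +
2n^2 + 4n + 32`.

For a bicyclic `G` the cycle space mod 2 has at most four elements, which bounds the short cycles
(`card_tuples_le`). If all degrees are at most `n - 2`, the sum of squared degrees is so small that
`(x - L) x^2 (x + a)^2`, with `L` an upper bound of the spectrum, already gives a strict inequality.
If some vertex is adjacent to all others, exactly two edges avoid it. When they share an endpoint,
`G` is `Y_n`; when they are disjoint, a quintic made for that graph gives strictness. -/

/-! ### Spectral moments as counts of closed walks -/

theorem Matrix.IsHermitian.sum_eigenvalues_pow {V : Type*} [Fintype V] [DecidableEq V]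
    {A : Matrix V V ℝ} (hA : A.IsHermitian) (k : ℕ) :
    ∑ i, hA.eigenvalues i ^ k = (A ^ k).trace := by
  conv_rhs => rw [hA.spectral_theorem, ← map_pow, Unitary.conjStarAlgAut_apply,
    Matrix.trace_mul_cycle, Unitary.coe_star_mul_self, one_mul, Matrix.diagonal_pow,
    Matrix.trace_diagonal]
  simp

theorem Matrix.IsHermitian.exists_eigenvector {V : Type*} [Fintype V] [DecidableEq V]
    {A : Matrix V V ℝ} (hA : A.IsHermitian) (i : V) :
    ∃ x : V → ℝ, x ≠ 0 ∧ A.mulVec x = hA.eigenvalues i • x :=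
  ⟨_, (WithLp.ofLp_eq_zero 2).ne.2 <| hA.eigenvectorBasis.orthonormal.ne_zero i,
    hA.mulVec_eigenvectorBasis i⟩

namespace SimpleGraph

variable {V : Type*} [Fintype V] (G : SimpleGraph V)

theorem resolventEnergy_eq_sum [DecidableEq V] [DecidableRel G.Adj] :
    G.resolventEnergy =
      ∑ i : V, 1 / ((Fintype.card V : ℝ) - (G.isHermitian_adjMatrix ℝ).eigenvalues i) := by
  unfold resolventEnergy
  congr!

/-- Roots of the characteristic polynomial form a multiset independent of any indexing by vertices,
which makes invariance under isomorphism immediate. -/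
theorem resolventEnergy_eq_sum_roots [DecidableEq V] [DecidableRel G.Adj] :
    G.resolventEnergy =
      ((G.adjMatrix ℝ).charpoly.roots.map fun x => 1 / ((Fintype.card V : ℝ) - x)).sum := by
  rw [resolventEnergy_eq_sum, (G.isHermitian_adjMatrix ℝ).roots_charpoly_eq_eigenvalues,
    Multiset.map_map]
  rfl

theorem Iso.resolventEnergy_eq {W : Type*} [Fintype W] {G : SimpleGraph V} {H : SimpleGraph W}
    (e : G ≃g H) : G.resolventEnergy = H.resolventEnergy := by
  classical
  rw [resolventEnergy_eq_sum_roots, resolventEnergy_eq_sum_roots,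
    ← Matrix.charpoly_reindex e.toEquiv, Fintype.card_congr e.toEquiv]
  congr 4
  exact e.reindex_adjMatrix ℝ

open scoped Classical in
/-- The ordered triples of pairwise adjacent vertices. -/
noncomputable def triangleTuples : Finset (V × V × V) :=
  univ.filter fun t => G.Adj t.1 t.2.1 ∧ G.Adj t.2.1 t.2.2 ∧ G.Adj t.2.2 t.1

open scoped Classical in
/-- The ordered quadruples of distinct vertices that are cyclically adjacent. -/
noncomputable def fourCycleTuples : Finset (V × V × V × V) :=
  univ.filter fun t => G.Adj t.1 t.2.1 ∧ G.Adj t.2.1 t.2.2.1 ∧ G.Adj t.2.2.1 t.2.2.2 ∧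
    G.Adj t.2.2.2 t.1 ∧ t.1 ≠ t.2.2.1 ∧ t.2.1 ≠ t.2.2.2

variable [DecidableEq V] [DecidableRel G.Adj]

theorem trace_adjMatrix_sq : ((G.adjMatrix ℝ) ^ 2).trace = ∑ v, (G.degree v : ℝ) := by
  simp only [sq, Matrix.trace, Matrix.diag, adjMatrix_mul_self_apply_self]

theorem trace_adjMatrix_cube : ((G.adjMatrix ℝ) ^ 3).trace = #G.triangleTuples := by
  rw [triangleTuples, Finset.card_filter]
  simp only [pow_succ, pow_zero, one_mul, Matrix.trace, Matrix.diag, Matrix.mul_apply,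
    adjMatrix_apply, Finset.sum_mul, Fintype.sum_prod_type]
  push_cast
  refine Finset.sum_congr rfl fun a _ => ?_
  rw [Finset.sum_comm]
  refine Finset.sum_congr rfl fun b _ => Finset.sum_congr rfl fun c _ => ?_
  by_cases h1 : G.Adj a b <;> by_cases h2 : G.Adj b c <;> by_cases h3 : G.Adj c a <;>
    simp [h1, h2, h3]

/-- A closed walk `a b c d` has `a = c`, or `b = d`, or is a genuine 4-cycle. Each degenerate kind
contributes the sum of squared degrees, and the walks with both coincidences are subtracted once. -/
theorem trace_adjMatrix_pow_four : ((G.adjMatrix ℝ) ^ 4).trace =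
    2 * ∑ v, (G.degree v : ℝ) ^ 2 - ∑ v, (G.degree v : ℝ) + #G.fourCycleTuples := by
  have hsum : ∀ a, ∑ b, (if G.Adj a b then (1 : ℝ) else 0) = G.degree a := by
    intro a
    rw [Finset.sum_boole, ← card_neighborFinset_eq_degree, neighborFinset_eq_filter]
  have hsq : ∀ a, (G.degree a : ℝ) ^ 2 =
      ∑ b, ∑ d, (if G.Adj a b then (1 : ℝ) else 0) * (if G.Adj a d then (1 : ℝ) else 0) := by
    intro a
    rw [← hsum, sq, Finset.sum_mul_sum]
  rw [fourCycleTuples, Finset.card_filter]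
  have hpow : (G.adjMatrix ℝ) ^ 4 =
      G.adjMatrix ℝ * G.adjMatrix ℝ * G.adjMatrix ℝ * G.adjMatrix ℝ := by noncomm_ring
  simp only [hpow, Matrix.trace, Matrix.diag, Matrix.mul_apply, adjMatrix_apply,
    Finset.sum_mul, Fintype.sum_prod_type]
  push_cast
  have h1 : ∑ v, (G.degree v : ℝ) ^ 2 = ∑ a, ∑ b, ∑ c, ∑ d, if a = c then
      (if G.Adj a b then (1 : ℝ) else 0) * (if G.Adj a d then (1 : ℝ) else 0) else 0 := by
    refine Finset.sum_congr rfl fun a _ => ?_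
    rw [hsq]
    refine Finset.sum_congr rfl fun b _ => ?_
    rw [Finset.sum_comm]
    simp
  have h2 : ∑ v, (G.degree v : ℝ) ^ 2 = ∑ a, ∑ b, ∑ c, ∑ d, if b = d then
      (if G.Adj b a then (1 : ℝ) else 0) * (if G.Adj b c then (1 : ℝ) else 0) else 0 := by
    rw [Finset.sum_comm]
    refine Finset.sum_congr rfl fun a _ => ?_
    rw [hsq]
    simp
  have h3 : ∑ v, (G.degree v : ℝ) = ∑ a, ∑ b, ∑ c, ∑ d, if a = c then if b = d then
      (if G.Adj a b then (1 : ℝ) else 0) else 0 else 0 := by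
    refine Finset.sum_congr rfl fun a _ => ?_
    rw [← hsum]
    refine Finset.sum_congr rfl fun b _ => ?_
    rw [Finset.sum_comm]
    simp
  rw [two_mul]
  nth_rewrite 1 [h1]
  rw [h2, h3]
  simp only [← Finset.sum_add_distrib, ← Finset.sum_sub_distrib]
  refine Finset.sum_congr rfl fun a _ => ?_
  trans ∑ d, ∑ c, ∑ b, (if G.Adj a b then (1 : ℝ) else 0) * (if G.Adj b c then 1 else 0) *
    (if G.Adj c d then 1 else 0) * (if G.Adj d a then 1 else 0)
  · rfl
  rw [Finset.sum_comm]
  rw [Finset.sum_congr rfl fun c _ => Finset.sum_comm, Finset.sum_comm]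
  refine Finset.sum_congr rfl fun b _ => Finset.sum_congr rfl fun c _ =>
    Finset.sum_congr rfl fun d _ => ?_
  by_cases hac : a = c
  · subst hac
    by_cases hbd : b = d
    · subst hbd
      by_cases h1 : G.Adj a b <;> simp [h1, G.adj_comm b a]
    · by_cases h1 : G.Adj a b <;> by_cases h2 : G.Adj a d <;>
        simp [h1, h2, hbd, G.adj_comm b a, G.adj_comm d a]
  · by_cases hbd : b = d
    · subst hbd
      by_cases h1 : G.Adj b a <;> by_cases h2 : G.Adj b c <;>
        simp [h1, h2, hac, G.adj_comm a b, G.adj_comm c b]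
    · by_cases h1 : G.Adj a b <;> by_cases h2 : G.Adj b c <;> by_cases h3 : G.Adj c d <;>
        by_cases h4 : G.Adj d a <;> simp [h1, h2, h3, h4, hac, hbd]

end SimpleGraph

/-! ### The cycle space modulo 2 and the number of short cycles -/

namespace SimpleGraph

variable {V : Type*} (G : SimpleGraph V)

/-- The boundary map modulo 2 of a graph, from sets of edges to sets of vertices. -/
noncomputable def boundaryMod2 [Fintype V] [DecidableEq V] [DecidableRel G.Adj] :
    (G.edgeSet → ZMod 2) →ₗ[ZMod 2] (V → ZMod 2) :=
  (Matrix.of fun (v : V) (e : G.edgeSet) => if v ∈ e.1 then (1 : ZMod 2) else 0).mulVecLin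

theorem boundaryMod2_apply [Fintype V] [DecidableEq V] [DecidableRel G.Adj]
    (f : G.edgeSet → ZMod 2) (v : V) :
    G.boundaryMod2 f v = ∑ e, if v ∈ e.1 then f e else 0 := by
  simp [boundaryMod2, Matrix.mulVec, dotProduct]

theorem boundaryMod2_single [Fintype V] [DecidableEq V] [DecidableRel G.Adj]
    {u v : V} (h : G.Adj u v) :
    G.boundaryMod2 (Pi.single ⟨s(u, v), h⟩ 1) = Pi.single u 1 + Pi.single v 1 := by
  ext w
  rw [boundaryMod2_apply, Finset.sum_eq_single ⟨s(u, v), h⟩]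
  · by_cases h1 : w = u
    · subst h1
      simp [h.ne]
    · by_cases h2 : w = v
      · subst h2
        simp [h1]
      · simp [h1, h2]
  · intro e _ he
    simp [Pi.single_eq_of_ne he]
  · simp

/-- Modulo boundaries all vertices of a connected graph are equal, as a walk to a root `r` shows. So
the range together with the single vector at `r` spans everything. -/
theorem finrank_range_boundaryMod2 [Fintype V] [DecidableEq V] [DecidableRel G.Adj]
    (hG : G.Connected) :
    Fintype.card V ≤ Module.finrank (ZMod 2) (LinearMap.range G.boundaryMod2) + 1 := by
  obtain ⟨r⟩ := hG.nonempty
  set R := LinearMap.range G.boundaryMod2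
  set S : Submodule (ZMod 2) (V → ZMod 2) := R ⊔ Submodule.span (ZMod 2) {Pi.single r 1} with hS
  have hmem : ∀ v, (Pi.single v 1 : V → ZMod 2) ∈ S := by
    intro v
    obtain ⟨p⟩ := hG.preconnected v r
    induction p with
    | nil => exact Submodule.mem_sup_right (Submodule.mem_span_singleton_self _)
    | @cons u v w h p ih =>
      have h1 : G.boundaryMod2 (Pi.single ⟨s(u, v), h⟩ 1) ∈ S :=
        Submodule.mem_sup_left (LinearMap.mem_range_self _ _)
      rw [boundaryMod2_single] at h1
      have h2 := S.sub_mem h1 (ih hS)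
      rwa [add_sub_cancel_right] at h2
  have htop : S = ⊤ := by
    rw [eq_top_iff]
    intro f _
    have : f = ∑ v, f v • (Pi.single v 1 : V → ZMod 2) := by
      ext w
      simp [Finset.sum_apply, Pi.single_apply]
    rw [this]
    exact S.sum_mem fun v _ => S.smul_mem _ (hmem v)
  have h1 : Module.finrank (ZMod 2) S = Fintype.card V := by
    rw [htop, finrank_top, Module.finrank_fintype_fun_eq_card]
  rw [← h1]
  refine (Submodule.finrank_add_le_finrank_add_finrank _ _).trans ?_
  rw [finrank_span_singleton (by simp)]

theorem card_ker_boundaryMod2_le [Fintype V] [DecidableEq V] [DecidableRel G.Adj]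
    (hG : G.IsBicyclic) :
    Nat.card (LinearMap.ker G.boundaryMod2) ≤ 4 := by
  have h1 := finrank_range_boundaryMod2 G hG.1
  have h2 := LinearMap.finrank_range_add_finrank_ker G.boundaryMod2
  have h3 := hG.2
  rw [Module.finrank_fintype_fun_eq_card] at h2
  rw [← Nat.card_coe_set_eq, Nat.card_eq_fintype_card] at h3
  have h4 : Module.finrank (ZMod 2) (LinearMap.ker G.boundaryMod2) ≤ 2 := by omega
  rw [Module.natCard_eq_pow_finrank (K := ZMod 2)]
  calc _ ≤ (Nat.card (ZMod 2)) ^ 2 := Nat.pow_le_pow_right (by simp) h4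
    _ = 4 := by simp

/-- The indicator modulo 2 of the edge `s(u, v)`. -/
def edgeVec [DecidableEq V]
    (u v : V) : G.edgeSet → ZMod 2 := fun e => if e.1 = s(u, v) then 1 else 0

theorem boundaryMod2_edgeVec [Fintype V] [DecidableEq V] [DecidableRel G.Adj]
    {u v : V} (h : G.Adj u v) :
    G.boundaryMod2 (G.edgeVec u v) = Pi.single u 1 + Pi.single v 1 := by
  rw [← boundaryMod2_single G h]
  congr 1
  ext e
  simp [edgeVec, Pi.single_apply, Subtype.ext_iff]

theorem sum_edgeVec [Fintype V] [DecidableEq V] [DecidableRel G.Adj]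
    {u v : V} (h : G.Adj u v) : ∑ e, G.edgeVec u v e = 1 := by
  rw [Finset.sum_eq_single ⟨s(u, v), h⟩]
  · simp [edgeVec]
  · intro e _ he
    simpa [edgeVec, Subtype.ext_iff] using he
  · simp

/-- The edge set modulo 2 of the closed walk through three vertices. -/
def triangleVec [DecidableEq V] (t : V × V × V) : G.edgeSet → ZMod 2 :=
  G.edgeVec t.1 t.2.1 + G.edgeVec t.2.1 t.2.2 + G.edgeVec t.2.2 t.1

/-- The edge set modulo 2 of the closed walk through four vertices. -/
def fourCycleVec [DecidableEq V] (t : V × V × V × V) : G.edgeSet → ZMod 2 :=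
  G.edgeVec t.1 t.2.1 + G.edgeVec t.2.1 t.2.2.1 + G.edgeVec t.2.2.1 t.2.2.2 +
    G.edgeVec t.2.2.2 t.1

theorem mem_of_triangleVec_ne_zero [DecidableEq V] {a b c : V} {e : G.edgeSet}
    (h : G.triangleVec (a, b, c) e ≠ 0) : e.1 = s(a, b) ∨ e.1 = s(b, c) ∨ e.1 = s(c, a) := by
  by_contra! hc
  simp [triangleVec, edgeVec, hc] at h

theorem mem_of_fourCycleVec_ne_zero [DecidableEq V] {a b c d : V} {e : G.edgeSet}
    (h : G.fourCycleVec (a, b, c, d) e ≠ 0) :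
    e.1 = s(a, b) ∨ e.1 = s(b, c) ∨ e.1 = s(c, d) ∨ e.1 = s(d, a) := by
  by_contra! hc
  simp [fourCycleVec, edgeVec, hc] at h

variable {G}

theorem triangleVec_mem_ker [Fintype V] [DecidableEq V] [DecidableRel G.Adj]
    {t : V × V × V} (ht : t ∈ G.triangleTuples) :
    G.triangleVec t ∈ LinearMap.ker G.boundaryMod2 := by
  simp only [triangleTuples, mem_filter, mem_univ, true_and] at ht
  obtain ⟨h1, h2, h3⟩ := ht
  rw [LinearMap.mem_ker, triangleVec, map_add, map_add, boundaryMod2_edgeVec _ h1,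
    boundaryMod2_edgeVec _ h2, boundaryMod2_edgeVec _ h3]
  ext w
  simp only [Pi.add_apply, Pi.zero_apply]
  exact (by decide : ∀ x y z : ZMod 2, x + y + (y + z) + (z + x) = 0) _ _ _

theorem fourCycleVec_mem_ker [Fintype V] [DecidableEq V] [DecidableRel G.Adj]
    {t : V × V × V × V} (ht : t ∈ G.fourCycleTuples) :
    G.fourCycleVec t ∈ LinearMap.ker G.boundaryMod2 := by
  simp only [fourCycleTuples, mem_filter, mem_univ, true_and] at ht
  obtain ⟨h1, h2, h3, h4, -, -⟩ := ht
  rw [LinearMap.mem_ker, fourCycleVec, map_add, map_add, map_add, boundaryMod2_edgeVec _ h1,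
    boundaryMod2_edgeVec _ h2, boundaryMod2_edgeVec _ h3, boundaryMod2_edgeVec _ h4]
  ext w
  simp only [Pi.add_apply, Pi.zero_apply]
  exact (by decide : ∀ x y z u : ZMod 2, x + y + (y + z) + (z + u) + (u + x) = 0) _ _ _ _

/-- The parity of the number of edges is linear on the cycle space; it separates triangles from
4-cycles. -/
theorem sum_triangleVec [Fintype V] [DecidableEq V] [DecidableRel G.Adj]
    {t : V × V × V} (ht : t ∈ G.triangleTuples) :
    ∑ e, G.triangleVec t e = 1 := by
  simp only [triangleTuples, mem_filter, mem_univ, true_and] at ht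
  obtain ⟨h1, h2, h3⟩ := ht
  simp only [triangleVec, Pi.add_apply, Finset.sum_add_distrib, sum_edgeVec _ h1,
    sum_edgeVec _ h2, sum_edgeVec _ h3]
  decide

theorem sum_fourCycleVec [Fintype V] [DecidableEq V] [DecidableRel G.Adj]
    {t : V × V × V × V} (ht : t ∈ G.fourCycleTuples) :
    ∑ e, G.fourCycleVec t e = 0 := by
  simp only [fourCycleTuples, mem_filter, mem_univ, true_and] at ht
  obtain ⟨h1, h2, h3, h4, -, -⟩ := ht
  simp only [fourCycleVec, Pi.add_apply, Finset.sum_add_distrib, sum_edgeVec _ h1,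
    sum_edgeVec _ h2, sum_edgeVec _ h3, sum_edgeVec _ h4]
  decide

/-- The three edges are distinct, so nothing cancels mod 2. -/
theorem triangleVec_apply_ne_zero [Fintype V] [DecidableEq V]
    {a b c : V} (ht : (a, b, c) ∈ G.triangleTuples)
    {e : G.edgeSet} (he : e.1 = s(a, b) ∨ e.1 = s(b, c) ∨ e.1 = s(c, a)) :
    G.triangleVec (a, b, c) e ≠ 0 := by
  simp only [triangleTuples, mem_filter, mem_univ, true_and] at ht
  obtain ⟨h1, h2, h3⟩ := ht
  rcases he with he | he | he <;>
    simp [triangleVec, edgeVec, he, h1.ne, h2.ne, h3.ne, h1.ne', h2.ne', h3.ne']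

theorem fourCycleVec_apply_ne_zero [Fintype V] [DecidableEq V]
    {a b c d : V} (ht : (a, b, c, d) ∈ G.fourCycleTuples)
    {e : G.edgeSet}
    (he : e.1 = s(a, b) ∨ e.1 = s(b, c) ∨ e.1 = s(c, d) ∨ e.1 = s(d, a)) :
    G.fourCycleVec (a, b, c, d) e ≠ 0 := by
  simp only [fourCycleTuples, mem_filter, mem_univ, true_and] at ht
  obtain ⟨h1, h2, h3, h4, h5, h6⟩ := ht
  rcases he with he | he | he | he <;>
    simp [fourCycleVec, edgeVec, he, h1.ne, h2.ne, h3.ne, h4.ne, h1.ne', h2.ne', h3.ne', h4.ne',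
      h5, h6, h5.symm, h6.symm]

/-- The edge set fixes a triangle up to its starting point and direction, so each cycle-space vector
comes from at most 6 tuples; likewise at most 8 for 4-cycles. -/
theorem eq_of_triangleVec_eq [Fintype V] [DecidableEq V]
    {a b c u v w : V} (ht : (a, b, c) ∈ G.triangleTuples)
    (ht' : (u, v, w) ∈ G.triangleTuples)
    (h : G.triangleVec (u, v, w) = G.triangleVec (a, b, c)) :
    (u, v, w) ∈ ({(a, b, c), (a, c, b), (b, a, c), (b, c, a), (c, a, b), (c, b, a)} :
      Finset (V × V × V)) := by
  have key : ∀ e : G.edgeSet, (e.1 = s(u, v) ∨ e.1 = s(v, w) ∨ e.1 = s(w, u)) →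
      (e.1 = s(a, b) ∨ e.1 = s(b, c) ∨ e.1 = s(c, a)) := fun e he =>
    mem_of_triangleVec_ne_zero G (h ▸ triangleVec_apply_ne_zero ht' he)
  simp only [triangleTuples, mem_filter, mem_univ, true_and] at ht ht'
  obtain ⟨h1, h2, h3⟩ := ht'
  have k1 := key ⟨s(u, v), h1⟩ (by simp)
  have k2 := key ⟨s(v, w), h2⟩ (by simp)
  have := h1.ne
  have := h2.ne
  have := h3.ne
  have := ht.1.ne
  have := ht.2.1.ne
  have := ht.2.2.ne
  simp only [Sym2.eq_iff] at k1 k2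
  simp only [mem_insert, mem_singleton, Prod.mk.injEq]
  clear key h
  grind

theorem eq_of_fourCycleVec_eq [Fintype V] [DecidableEq V]
    {a b c d u v w x : V} (ht : (a, b, c, d) ∈ G.fourCycleTuples)
    (ht' : (u, v, w, x) ∈ G.fourCycleTuples)
    (h : G.fourCycleVec (u, v, w, x) = G.fourCycleVec (a, b, c, d)) :
    (u, v, w, x) ∈ ({(a, b, c, d), (b, c, d, a), (c, d, a, b), (d, a, b, c), (d, c, b, a),
      (c, b, a, d), (b, a, d, c), (a, d, c, b)} : Finset (V × V × V × V)) := by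
  have key : ∀ e : G.edgeSet,
      (e.1 = s(u, v) ∨ e.1 = s(v, w) ∨ e.1 = s(w, x) ∨ e.1 = s(x, u)) →
      (e.1 = s(a, b) ∨ e.1 = s(b, c) ∨ e.1 = s(c, d) ∨ e.1 = s(d, a)) := fun e he =>
    mem_of_fourCycleVec_ne_zero G (h ▸ fourCycleVec_apply_ne_zero ht' he)
  simp only [fourCycleTuples, mem_filter, mem_univ, true_and] at ht ht'
  obtain ⟨h1, h2, h3, h4, h5, h6⟩ := ht'
  have k1 := key ⟨s(u, v), h1⟩ (by simp)
  have k2 := key ⟨s(v, w), h2⟩ (by simp)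
  have k3 := key ⟨s(w, x), h3⟩ (by simp)
  have := h1.ne
  have := h2.ne
  have := h3.ne
  have := h4.ne
  have := ht.1.ne
  have := ht.2.1.ne
  have := ht.2.2.1.ne
  have := ht.2.2.2.1.ne
  have := ht.2.2.2.2
  simp only [Sym2.eq_iff] at k1 k2 k3
  simp only [mem_insert, mem_singleton, Prod.mk.injEq]
  clear key h ht
  rcases k1 with (⟨rfl, rfl⟩ | ⟨rfl, rfl⟩) | (⟨rfl, rfl⟩ | ⟨rfl, rfl⟩) |
    (⟨rfl, rfl⟩ | ⟨rfl, rfl⟩) | (⟨rfl, rfl⟩ | ⟨rfl, rfl⟩) <;> grind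

/-- In a bicyclic graph the numbers of ordered triangles and ordered 4-cycles are at most those of
`θ(2, 2, 1)`, unless there is no triangle; then there are at most three 4-cycles. -/
theorem IsBicyclic.card_tuples_le [Fintype V] (hG : G.IsBicyclic) :
    (#G.triangleTuples ≤ 12 ∧ #G.fourCycleTuples ≤ 8) ∨
      (#G.triangleTuples = 0 ∧ #G.fourCycleTuples ≤ 24) := by
  classical
  set K : Finset (G.edgeSet → ZMod 2) := univ.filter (· ∈ LinearMap.ker G.boundaryMod2) with hK
  have hKmem : ∀ f, f ∈ K ↔ f ∈ LinearMap.ker G.boundaryMod2 := by simp [hK]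
  have hKcard : #K ≤ 4 := by
    have := card_ker_boundaryMod2_le G hG
    rwa [Nat.card_eq_fintype_card, Fintype.card_subtype] at this
  -- `K1` and `K0` are the cycle-space elements with an odd and an even number of edges. Triangles
  -- land in `K1`, 4-cycles in `K0` without its zero element.
  set K1 := K.filter (fun f => ∑ e, f e = 1)
  set K0 := K.filter (fun f => ∑ e, f e = 0)
  have hsplit : #K0 + #K1 ≤ 4 := by
    rw [← Finset.card_union_of_disjoint]
    · exact (Finset.card_le_card (Finset.union_subset (filter_subset _ _)
        (filter_subset _ _))).trans hKcard
    · rw [Finset.disjoint_filter]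
      intro f _ h0 h1
      exact zero_ne_one (h0.symm.trans h1)
  have hzero : (0 : G.edgeSet → ZMod 2) ∈ K0 := by simp [K0, hKmem]
  have h3 : #G.triangleTuples ≤ 6 * #K1 := by
    refine (Finset.card_le_mul_card_image (f := G.triangleVec) _ 6 ?_).trans
      (Nat.mul_le_mul_left _ (Finset.card_le_card ?_))
    · intro f hf
      obtain ⟨⟨a, b, c⟩, ht, rfl⟩ := Finset.mem_image.mp hf
      refine (Finset.card_le_card (t := {(a, b, c), (a, c, b), (b, a, c), (b, c, a), (c, a, b),
        (c, b, a)}) ?_).trans Finset.card_le_six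
      rintro ⟨u, v, w⟩ h
      rw [mem_filter] at h
      exact eq_of_triangleVec_eq ht h.1 h.2
    · intro f hf
      obtain ⟨t, ht, rfl⟩ := Finset.mem_image.mp hf
      simp only [K1, mem_filter, hKmem]
      exact ⟨triangleVec_mem_ker ht, sum_triangleVec ht⟩
  have h4 : #G.fourCycleTuples ≤ 8 * #(K0.erase 0) := by
    refine (Finset.card_le_mul_card_image (f := G.fourCycleVec) _ 8 ?_).trans
      (Nat.mul_le_mul_left _ (Finset.card_le_card ?_))
    · intro f hf
      obtain ⟨⟨a, b, c, d⟩, ht, rfl⟩ := Finset.mem_image.mp hf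
      refine (Finset.card_le_card (t := {(a, b, c, d), (b, c, d, a), (c, d, a, b), (d, a, b, c),
        (d, c, b, a), (c, b, a, d), (b, a, d, c), (a, d, c, b)}) ?_).trans ?_
      · rintro ⟨u, v, w, x⟩ h
        rw [mem_filter] at h
        exact eq_of_fourCycleVec_eq ht h.1 h.2
      · refine (Finset.card_insert_le _ _).trans (Nat.succ_le_succ ?_)
        refine (Finset.card_insert_le _ _).trans (Nat.succ_le_succ ?_)
        exact Finset.card_le_six
    · intro f hf
      obtain ⟨⟨a, b, c, d⟩, ht, rfl⟩ := Finset.mem_image.mp hf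
      simp only [K0, mem_erase, mem_filter, hKmem]
      refine ⟨?_, fourCycleVec_mem_ker ht, sum_fourCycleVec ht⟩
      intro h0
      have hab : G.Adj a b := by
        simp only [fourCycleTuples, mem_filter] at ht
        exact ht.2.1
      exact fourCycleVec_apply_ne_zero ht (e := ⟨s(a, b), hab⟩) (by simp) (by rw [h0]; rfl)
  rw [Finset.card_erase_of_mem hzero] at h4
  rcases K1.eq_empty_or_nonempty with he | ⟨g, hg⟩
  · right
    rw [he, Finset.card_empty] at h3
    omega
  · left
    -- Translation by the odd element `g` exchanges the two parities, so each class has at most two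
    -- elements.
    have hle : #K1 ≤ #K0 := by
      refine Finset.card_le_card_of_injOn (· + g) ?_ (fun x _ y _ h => add_right_cancel h)
      intro f hf
      simp only [K1, K0, coe_filter, mem_filter, hKmem, Set.mem_ofPred_eq] at hf hg ⊢
      refine ⟨Submodule.add_mem _ hf.1 hg.1, ?_⟩
      simp only [Pi.add_apply, Finset.sum_add_distrib, hf.2, hg.2]
      decide
    have hle' : #K0 ≤ #K1 := by
      refine Finset.card_le_card_of_injOn (· + g) ?_ (fun x _ y _ h => add_right_cancel h)
      intro f hf
      simp only [K1, K0, coe_filter, mem_filter, hKmem, Set.mem_ofPred_eq] at hf hg ⊢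
      refine ⟨Submodule.add_mem _ hf.1 hg.1, ?_⟩
      simp only [Pi.add_apply, Finset.sum_add_distrib, hf.2, hg.2, zero_add]
    omega

end SimpleGraph

/-! ### Sums of squared degrees -/

/-- Equality holds at `a = n - 3`, `b = 3`, `c = 1`. With the slack `r = n - a - b`, the right side
minus the left is `2 (a - b) (b + r - 3)` plus an expression free of `a`; the first term is
nonnegative, and the second is treated by the size of `r`. -/
theorem sq_add_sq_add_mul_le {a b c n : ℤ} (hab : b ≤ a) (hbc : c ≤ b) (hc : 0 ≤ c)
    (h1 : a ≤ n - 3) (h2 : a + b ≤ n) (h3 : a + b + c ≤ n + 1) :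
    a ^ 2 + b ^ 2 + c * (n + 2 - a - b) ≤ (n - 3) ^ 2 + 11 := by
  obtain ⟨r, hr⟩ : ∃ r, r = n - a - b := ⟨_, rfl⟩
  obtain rfl : n = a + b + r := by omega
  have hk : 0 ≤ (a - b) * (b + r - 3) := mul_nonneg (by omega) (by omega)
  suffices 0 ≤ 2 * b ^ 2 + 4 * b * r - 12 * b + (r - 3) ^ 2 + 11 - c * (r + 2) by
    nlinarith
  have hr0 : 0 ≤ r := by omega
  by_cases h4 : 4 ≤ r
  · nlinarith [mul_nonneg (by omega : 0 ≤ b - c) (by omega : 0 ≤ r + 2),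
      mul_nonneg (by omega : 0 ≤ b) (by omega : 0 ≤ r - 4), sq_nonneg (b - 1), sq_nonneg (r - 3)]
  · interval_cases r
    · nlinarith [sq_nonneg (b - 3)]
    · rcases (by omega : b ≤ 2 ∨ 3 ≤ b) with hb | hb
      · nlinarith [mul_nonneg (by omega : 0 ≤ 2 - b) (by omega : 0 ≤ 3 - b)]
      · nlinarith [mul_nonneg (by omega : 0 ≤ b - 3) (by omega : 0 ≤ 2 * b - 5)]
    · nlinarith [sq_nonneg (b - 2)]
    · nlinarith [sq_nonneg (b - 1)]

/-- Split off the two largest values `y u` and `y v`. The others are at most the third largest `y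
w`, so their squares sum to at most `y w` times their sum. -/
theorem sum_sq_le_of_pair_triple_bounds {V : Type*} [Fintype V] (hV : 3 ≤ Fintype.card V)
    (y : V → ℤ) (n : ℤ) (h0 : ∀ v, 0 ≤ y v) (hs : ∑ v, y v = n + 2) (h1 : ∀ v, y v ≤ n - 3)
    (h2 : ∀ u v, u ≠ v → y u + y v ≤ n)
    (h3 : ∀ u v w, u ≠ v → u ≠ w → v ≠ w → y u + y v + y w ≤ n + 1) :
    ∑ v, y v ^ 2 ≤ (n - 3) ^ 2 + 11 := by
  classical
  have hc0 : #(univ : Finset V) = Fintype.card V := Finset.card_univ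
  obtain ⟨u, -, hu⟩ := (univ : Finset V).exists_max_image y
    (Finset.card_pos.mp (by omega))
  have hc1 := Finset.card_erase_of_mem (mem_univ u)
  obtain ⟨v, hv, hv'⟩ := (univ.erase u).exists_max_image y (Finset.card_pos.mp (by omega))
  have hc2 := Finset.card_erase_of_mem hv
  obtain ⟨w, hw, hw'⟩ := ((univ.erase u).erase v).exists_max_image y
    (Finset.card_pos.mp (by omega))
  have hvu : v ≠ u := Finset.ne_of_mem_erase hv
  have hwv : w ≠ v := Finset.ne_of_mem_erase hw
  have hwu : w ≠ u := Finset.ne_of_mem_erase (Finset.mem_of_mem_erase hw)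
  have e1 := Finset.add_sum_erase univ (fun v => y v ^ 2) (mem_univ u)
  have e2 := Finset.add_sum_erase (univ.erase u) (fun v => y v ^ 2) hv
  have e3 := Finset.add_sum_erase univ y (mem_univ u)
  have e4 := Finset.add_sum_erase (univ.erase u) y hv
  have e5 : ∑ x ∈ (univ.erase u).erase v, y x ^ 2 ≤ y w * ∑ x ∈ (univ.erase u).erase v, y x := by
    rw [Finset.mul_sum]
    refine Finset.sum_le_sum fun x hx => ?_
    rw [sq]
    exact mul_le_mul_of_nonneg_right (hw' x hx) (h0 x)
  have e6 : ∑ x ∈ (univ.erase u).erase v, y x = n + 2 - y u - y v := by linarith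
  rw [e6] at e5
  have := sq_add_sq_add_mul_le (hu v (mem_univ v)) (hv' w (Finset.mem_of_mem_erase hw)) (h0 w)
    (h1 u) (h2 u v hvu.symm) (h3 u v w hvu.symm hwu.symm hwv.symm)
  linarith

namespace SimpleGraph

theorem IsBicyclic.card_edgeFinset {V : Type*} [Fintype V] {G : SimpleGraph V}
    [Fintype G.edgeSet] (hG : G.IsBicyclic) : #G.edgeFinset = Fintype.card V + 1 := by
  rw [← hG.2, ← coe_edgeFinset, Set.ncard_coe_finset]

theorem IsBicyclic.sum_degrees {V : Type*} [Fintype V] {G : SimpleGraph V} [DecidableRel G.Adj]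
    (hG : G.IsBicyclic) : ∑ v, (G.degree v : ℤ) = 2 * (Fintype.card V + 1) := by
  classical
  have := G.sum_degrees_eq_twice_card_edges
  rw [hG.card_edgeFinset] at this
  exact_mod_cast this

/-- Degrees lie between 1 and 3, so `(d - 1) (d - 3) ≤ 0`; summing gives `4 * 12 - 15 = 33`. This is
one better than the general formula `n^2 - 3n + 24` at `n = 5`. -/
theorem IsBicyclic.sum_degree_sq_le_of_card_eq_five {V : Type*} [Fintype V] {G : SimpleGraph V}
    [DecidableRel G.Adj] (hG : G.IsBicyclic) (hV : Fintype.card V = 5)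
    (hd : ∀ v, G.degree v ≤ 3) :
    ∑ v, (G.degree v : ℤ) ^ 2 ≤ 33 := by
  have : Nontrivial V := Fintype.one_lt_card_iff_nontrivial.mp (by omega)
  have hpos : ∀ v, 0 < G.degree v := fun v => hG.1.preconnected.degree_pos_of_nontrivial v
  have hs := hG.sum_degrees
  have h : ∑ v, (G.degree v : ℤ) ^ 2 ≤ ∑ v, (4 * (G.degree v : ℤ) - 3) := by
    refine Finset.sum_le_sum fun v _ => ?_
    have h1 := hpos v
    have h2 := hd v
    nlinarith
  rw [Finset.sum_sub_distrib, ← Finset.mul_sum, hs, hV] at h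
  simpa [hV] using h

variable {V : Type*} [Fintype V] (G : SimpleGraph V) [DecidableEq V] [DecidableRel G.Adj]

theorem card_incidenceFinset_inter_le {u v : V} (h : u ≠ v) :
    #(G.incidenceFinset u ∩ G.incidenceFinset v) ≤ 1 := by
  rw [Finset.card_le_one]
  intro e he f hf
  simp only [mem_inter, mem_incidenceFinset, incidenceSet, Set.mem_sep_iff] at he hf
  rw [(Sym2.mem_and_mem_iff h).mp ⟨he.1.2, he.2.2⟩, (Sym2.mem_and_mem_iff h).mp ⟨hf.1.2, hf.2.2⟩]

/-- Two distinct vertices share at most one edge, so inclusion–exclusion on incidence sets loses at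
most 1; for three vertices it loses at most 3. -/
theorem degree_add_degree_le {u v : V} (h : u ≠ v) :
    G.degree u + G.degree v ≤ #G.edgeFinset + 1 := by
  have h1 := Finset.card_union_add_card_inter (G.incidenceFinset u) (G.incidenceFinset v)
  have h2 := G.card_incidenceFinset_inter_le h
  have h3 := Finset.card_le_card (Finset.union_subset (G.incidenceFinset_subset u)
    (G.incidenceFinset_subset v))
  rw [card_incidenceFinset_eq_degree, card_incidenceFinset_eq_degree] at h1
  omega

theorem degree_add_degree_add_degree_le {u v w : V} (h : u ≠ v) (h' : u ≠ w) (h'' : v ≠ w) :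
    G.degree u + G.degree v + G.degree w ≤ #G.edgeFinset + 3 := by
  have h1 := Finset.card_union_add_card_inter (G.incidenceFinset u) (G.incidenceFinset v)
  have h2 := G.card_incidenceFinset_inter_le h
  have h3 := Finset.card_union_add_card_inter (G.incidenceFinset u ∪ G.incidenceFinset v)
    (G.incidenceFinset w)
  have h4 : #((G.incidenceFinset u ∪ G.incidenceFinset v) ∩ G.incidenceFinset w) ≤ 2 := by
    rw [Finset.union_inter_distrib_right]
    exact (Finset.card_union_le _ _).trans (Nat.add_le_add
      (G.card_incidenceFinset_inter_le h') (G.card_incidenceFinset_inter_le h''))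
  have h5 := Finset.card_le_card (Finset.union_subset (Finset.union_subset
    (G.incidenceFinset_subset u) (G.incidenceFinset_subset v)) (G.incidenceFinset_subset w))
  rw [card_incidenceFinset_eq_degree, card_incidenceFinset_eq_degree] at h1
  rw [card_incidenceFinset_eq_degree] at h3
  omega

variable {G}

theorem IsBicyclic.sum_degree_sq_le (hG : G.IsBicyclic) (hV : 6 ≤ Fintype.card V)
    (hd : ∀ v, G.degree v ≤ Fintype.card V - 2) :
    ∑ v, (G.degree v : ℤ) ^ 2 ≤ (Fintype.card V : ℤ) ^ 2 - 3 * Fintype.card V + 24 := by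
  have : Nontrivial V := Fintype.one_lt_card_iff_nontrivial.mp (by omega)
  have hpos : ∀ v, 0 < G.degree v := fun v => hG.1.preconnected.degree_pos_of_nontrivial v
  have hm := hG.card_edgeFinset
  have hs := hG.sum_degrees
  have hsum : ∑ v, ((G.degree v : ℤ) - 1) = (Fintype.card V : ℤ) + 2 := by
    rw [Finset.sum_sub_distrib, hs]
    simp
    ring
  -- Connectedness makes `degree - 1` nonnegative. With `n + 1` edges, pairs of these numbers sum to
  -- at most `n + 2 - 2` and triples to at most `n + 4 - 3`.
  have key := sum_sq_le_of_pair_triple_bounds (by omega) (fun v => (G.degree v : ℤ) - 1)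
    (Fintype.card V) (fun v => by have := hpos v; omega) hsum
    (fun v => by have := hd v; omega)
    (fun u v h => by have := G.degree_add_degree_le h; omega)
    (fun u v w h h' h'' => by have := G.degree_add_degree_add_degree_le h h' h''; omega)
  have e : ∑ v, (G.degree v : ℤ) ^ 2 = ∑ v, ((G.degree v : ℤ) - 1) ^ 2 +
      2 * ∑ v, ((G.degree v : ℤ) - 1) + Fintype.card V := by
    have : (Fintype.card V : ℤ) = ∑ v : V, 1 := by simp
    rw [this, Finset.mul_sum, ← Finset.sum_add_distrib, ← Finset.sum_add_distrib]
    exact Finset.sum_congr rfl fun v _ => by ring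
  rw [e, hsum]
  linarith

end SimpleGraph

/-! ### The quintic identity, and graphs without a dominating vertex -/

namespace SimpleGraph

section Spectral

variable {V : Type*} [Fintype V] (G : SimpleGraph V) [DecidableEq V] [DecidableRel G.Adj]

theorem sum_adjMatrix_eigenvalues : ∑ i, (G.isHermitian_adjMatrix ℝ).eigenvalues i = 0 := by
  have h := (G.isHermitian_adjMatrix ℝ).sum_eigenvalues_pow 1
  simpa [trace_adjMatrix] using h

/-- A monic quintic without constant term expresses the resolvent energy through the first four
spectral moments, up to an error that only involves the values of the quintic at the
eigenvalues. -/
theorem resolventEnergy_mul_quintic {N : ℝ} (hN : (Fintype.card V : ℝ) = N) (p q r s : ℝ)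
    (hne : ∀ i, (G.isHermitian_adjMatrix ℝ).eigenvalues i ≠ N) :
    G.resolventEnergy * (N ^ 5 + p * N ^ 4 + q * N ^ 3 + r * N ^ 2 + s * N) =
      (N ^ 5 + p * N ^ 4 + q * N ^ 3 + r * N ^ 2 + s * N) +
      (N ^ 2 + p * N + q) * ∑ v, (G.degree v : ℝ) + (N + p) * #G.triangleTuples +
      (2 * ∑ v, (G.degree v : ℝ) ^ 2 - ∑ v, (G.degree v : ℝ) + #G.fourCycleTuples) +
      ∑ i, ((G.isHermitian_adjMatrix ℝ).eigenvalues i ^ 5 +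
        p * (G.isHermitian_adjMatrix ℝ).eigenvalues i ^ 4 +
        q * (G.isHermitian_adjMatrix ℝ).eigenvalues i ^ 3 +
        r * (G.isHermitian_adjMatrix ℝ).eigenvalues i ^ 2 +
        s * (G.isHermitian_adjMatrix ℝ).eigenvalues i) /
          (N - (G.isHermitian_adjMatrix ℝ).eigenvalues i) := by
  have hA := G.isHermitian_adjMatrix ℝ
  rw [← trace_adjMatrix_pow_four, ← trace_adjMatrix_cube, ← trace_adjMatrix_sq,
    ← hA.sum_eigenvalues_pow, ← hA.sum_eigenvalues_pow, ← hA.sum_eigenvalues_pow,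
    resolventEnergy_eq_sum, hN]
  have h1 := G.sum_adjMatrix_eigenvalues
  set l := hA.eigenvalues
  -- The zeroth moment is `N` and the quintic has no constant term, so this moment contributes
  -- exactly the quintic at `N`. The first moment vanishes and is inserted as a zero, after which
  -- the identity holds eigenvalue by eigenvalue.
  have h0 : N ^ 5 + p * N ^ 4 + q * N ^ 3 + r * N ^ 2 + s * N =
      ∑ i : V, (N ^ 4 + p * N ^ 3 + q * N ^ 2 + r * N + s) := by
    rw [Finset.sum_const, Finset.card_univ, nsmul_eq_mul, hN]
    ring
  have h1' : ∑ i, (N ^ 3 + p * N ^ 2 + q * N + r) * l i = 0 := by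
    rw [← Finset.mul_sum, h1, mul_zero]
  conv_rhs => rw [h0, ← add_zero (∑ i : V, _), ← h1']
  rw [Finset.sum_mul, Finset.mul_sum, Finset.mul_sum]
  simp only [← Finset.sum_add_distrib]
  refine Finset.sum_congr rfl fun i _ => ?_
  have hi : N - l i ≠ 0 := sub_ne_zero.mpr (hne i).symm
  change 1 / (N - l i) * _ = _
  field_simp
  ring

theorem eigenvalue_sq_le (i : V) :
    (G.isHermitian_adjMatrix ℝ).eigenvalues i ^ 2 ≤ ∑ v, (G.degree v : ℝ) := by
  rw [← trace_adjMatrix_sq, ← (G.isHermitian_adjMatrix ℝ).sum_eigenvalues_pow]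
  exact Finset.single_le_sum (f := fun j => (G.isHermitian_adjMatrix ℝ).eigenvalues j ^ 2)
    (fun j _ => sq_nonneg _) (mem_univ i)

/-- The right side is the sum of `(λ (λ + a)) ^ 2` over all eigenvalues, written through the moments
of orders 4, 3 and 2; one term is at most the sum. -/
theorem eigenvalue_quartic_le (a : ℝ) (i : V) :
    ((G.isHermitian_adjMatrix ℝ).eigenvalues i *
        ((G.isHermitian_adjMatrix ℝ).eigenvalues i + a)) ^ 2 ≤
      (2 * ∑ v, (G.degree v : ℝ) ^ 2 - ∑ v, (G.degree v : ℝ) + #G.fourCycleTuples) +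
        2 * a * #G.triangleTuples + a ^ 2 * ∑ v, (G.degree v : ℝ) := by
  have hA := G.isHermitian_adjMatrix ℝ
  rw [← trace_adjMatrix_pow_four, ← trace_adjMatrix_cube, ← trace_adjMatrix_sq,
    ← hA.sum_eigenvalues_pow, ← hA.sum_eigenvalues_pow, ← hA.sum_eigenvalues_pow]
  rw [Finset.mul_sum, Finset.mul_sum, ← Finset.sum_add_distrib, ← Finset.sum_add_distrib]
  refine (Finset.single_le_sum (f := fun j => (hA.eigenvalues j * (hA.eigenvalues j + a)) ^ 2)
    (fun j _ => sq_nonneg _) (mem_univ i)).trans_eq ?_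
  exact Finset.sum_congr rfl fun j _ => by ring

end Spectral

variable {V : Type*} [Fintype V] {G : SimpleGraph V}

theorem IsBicyclic.sum_degrees_real [DecidableRel G.Adj] (hG : G.IsBicyclic) :
    ∑ v, (G.degree v : ℝ) = 2 * (Fintype.card V + 1) := by
  exact_mod_cast hG.sum_degrees

theorem IsBicyclic.eigenvalue_lt_card [DecidableEq V] [DecidableRel G.Adj] (hG : G.IsBicyclic)
    (hV : 5 ≤ Fintype.card V) (i : V) :
    (G.isHermitian_adjMatrix ℝ).eigenvalues i < Fintype.card V := by
  have h := G.eigenvalue_sq_le i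
  rw [hG.sum_degrees_real] at h
  have : (5 : ℝ) ≤ Fintype.card V := by exact_mod_cast hV
  nlinarith

/-- The threshold `4 / 3` is where the triangle-free bound 24 equals `12 c + 8`. -/
theorem IsBicyclic.mul_card_triangleTuples_add_le (hG : G.IsBicyclic) {c : ℝ} (hc : 4 / 3 ≤ c) :
    c * #G.triangleTuples + #G.fourCycleTuples ≤ 12 * c + 8 := by
  rcases hG.card_tuples_le with ⟨h3, h4⟩ | ⟨h3, h4⟩
  · have h3' : (#G.triangleTuples : ℝ) ≤ 12 := by exact_mod_cast h3
    have h4' : (#G.fourCycleTuples : ℝ) ≤ 8 := by exact_mod_cast h4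
    nlinarith
  · have h4' : (#G.fourCycleTuples : ℝ) ≤ 24 := by exact_mod_cast h4
    rw [h3]
    push_cast
    linarith

/-- The quintic is `(x - L) (x (x + a)) ^ 2`. Hypothesis `h1` forces every eigenvalue below `L`,
which makes it nonpositive on the spectrum, and `h2` is the resulting comparison with the value for
`Y_n`, cross-multiplied. In `hB`, `2 N - 6` is the degree sum `2 (N + 1)` minus the 8 allowed for
4-cycle tuples. -/
theorem IsBicyclic.resolventEnergy_lt_of_bounds [DecidableRel G.Adj] (hG : G.IsBicyclic)
    (hV : 5 ≤ Fintype.card V) {N L a B : ℝ} (hN : (Fintype.card V : ℝ) = N)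
    (ha : 2 / 3 ≤ a) (hL : 0 < L) (hLN : L < N) (hc : 4 / 3 ≤ N + 2 * a - L)
    (hB : 2 * ∑ v, (G.degree v : ℝ) ^ 2 ≤ B + 2 * N - 6)
    (h1 : B + 24 * a + a ^ 2 * (2 * (N + 1)) < (L * (L + a)) ^ 2)
    (h2 : (N ^ 4 - N ^ 3 - N ^ 2 - 2 * N - 8) * (B + 12 * (N + 2 * a - L) +
        2 * (N + 1) * (N ^ 2 + (2 * a - L) * N + (a ^ 2 - 2 * a * L))) <
      (2 * N ^ 3 + 2 * N ^ 2 + 4 * N + 32) * N * ((N - L) * (N + a) ^ 2)) :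
    (G.resolventEnergy - 1) * (N * (N ^ 4 - N ^ 3 - N ^ 2 - 2 * N - 8)) <
      2 * N ^ 3 + 2 * N ^ 2 + 4 * N + 32 := by
  classical
  have hN5 : 5 ≤ N := by rw [← hN]; exact_mod_cast hV
  have hs := hG.sum_degrees_real
  rw [hN] at hs
  have hlt : ∀ i, (G.isHermitian_adjMatrix ℝ).eigenvalues i < N := fun i =>
    hN ▸ hG.eigenvalue_lt_card hV i
  have hle : ∀ i, (G.isHermitian_adjMatrix ℝ).eigenvalues i ≤ L := by
    intro i
    have h := G.eigenvalue_quartic_le a i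
    have h' := hG.mul_card_triangleTuples_add_le (c := 2 * a) (by linarith)
    by_contra! hcon
    have : (L * (L + a)) ^ 2 ≤ ((G.isHermitian_adjMatrix ℝ).eigenvalues i *
        ((G.isHermitian_adjMatrix ℝ).eigenvalues i + a)) ^ 2 := by
      gcongr
      exact hL.le.trans hcon.le
    rw [hs] at h
    linarith
  have key := G.resolventEnergy_mul_quintic hN (2 * a - L) (a ^ 2 - 2 * a * L) (-a ^ 2 * L) 0
    (fun i => (hlt i).ne)
  have hneg : ∑ i, ((G.isHermitian_adjMatrix ℝ).eigenvalues i ^ 5 +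
        (2 * a - L) * (G.isHermitian_adjMatrix ℝ).eigenvalues i ^ 4 +
        (a ^ 2 - 2 * a * L) * (G.isHermitian_adjMatrix ℝ).eigenvalues i ^ 3 +
        (-a ^ 2 * L) * (G.isHermitian_adjMatrix ℝ).eigenvalues i ^ 2 +
        0 * (G.isHermitian_adjMatrix ℝ).eigenvalues i) /
          (N - (G.isHermitian_adjMatrix ℝ).eigenvalues i) ≤ 0 := by
    refine Finset.sum_nonpos fun i _ => ?_
    refine div_nonpos_of_nonpos_of_nonneg ?_ (sub_nonneg.mpr (hlt i).le)
    generalize hl : (G.isHermitian_adjMatrix ℝ).eigenvalues i = l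
    have hl' : l ≤ L := hl ▸ hle i
    have : 0 ≤ (L - l) * (l * (l + a)) ^ 2 := mul_nonneg (by linarith) (sq_nonneg _)
    linarith
  have h' := hG.mul_card_triangleTuples_add_le hc
  rw [hs] at key
  set W := (N - L) * (N + a) ^ 2 with hW
  have hWpos : 0 < W := mul_pos (by linarith) (by positivity)
  have hD : 0 < N ^ 4 - N ^ 3 - N ^ 2 - 2 * N - 8 := by
    have : 0 ≤ (N - 5) * N ^ 3 := mul_nonneg (by linarith) (by positivity)
    nlinarith [mul_nonneg (by linarith : 0 ≤ N - 5) (sq_nonneg N)]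
  have hX : (G.resolventEnergy - 1) * (N ^ 2 * W) ≤ B + 12 * (N + 2 * a - L) +
      2 * (N + 1) * (N ^ 2 + (2 * a - L) * N + (a ^ 2 - 2 * a * L)) := by
    have e : N ^ 5 + (2 * a - L) * N ^ 4 + (a ^ 2 - 2 * a * L) * N ^ 3 + -a ^ 2 * L * N ^ 2 + 0 * N
      = N ^ 2 * W := by rw [hW]; ring
    rw [e] at key
    linarith
  have h3 := mul_le_mul_of_nonneg_left hX hD.le
  have h4 := h3.trans_lt h2
  refine lt_of_mul_lt_mul_right (a := N * W) ?_ (by positivity)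
  linarith

theorem IsBicyclic.resolventEnergy_lt_of_degree_le [DecidableRel G.Adj] (hG : G.IsBicyclic)
    (hV : 5 ≤ Fintype.card V) {N : ℝ} (hN : (Fintype.card V : ℝ) = N)
    (hd : ∀ v, G.degree v ≤ Fintype.card V - 2) :
    (G.resolventEnergy - 1) * (N * (N ^ 4 - N ^ 3 - N ^ 2 - 2 * N - 8)) <
      2 * N ^ 3 + 2 * N ^ 2 + 4 * N + 32 := by
  classical
  rcases hV.eq_or_lt with h5 | h6
  · have hN5 : N = 5 := by rw [← hN, ← h5]; norm_num
    have hsq : ∑ v, (G.degree v : ℝ) ^ 2 ≤ 33 := by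
      exact_mod_cast hG.sum_degree_sq_le_of_card_eq_five h5.symm fun v => by
        have := hd v; omega
    refine hG.resolventEnergy_lt_of_bounds hV hN (L := 27 / 10) (a := 3 / 2) (B := 62)
      ?_ ?_ ?_ ?_ ?_ ?_ ?_ <;> subst hN5
    · norm_num
    · norm_num
    · norm_num
    · norm_num
    · linarith
    · norm_num
    · norm_num
  · have hsq : ∑ v, (G.degree v : ℝ) ^ 2 ≤ N ^ 2 - 3 * N + 24 := by
      rw [← hN]
      exact_mod_cast hG.sum_degree_sq_le h6 hd
    have hN6 : 6 ≤ N := by rw [← hN]; exact_mod_cast h6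
    -- The parameters are `L = √N + 3/8` and `a = √N - 3/4`. As `12/5 < √6`, the shift `x = √N -
    -- 12/5` is nonnegative, and the two main inequalities become polynomials in `x` whose
    -- positivity is visible from their coefficients.
    obtain ⟨x, hx, rfl⟩ : ∃ x : ℝ, 0 ≤ x ∧ N = (x + 12 / 5) ^ 2 := by
      refine ⟨√N - 12 / 5, ?_, ?_⟩
      · have : (12 / 5 : ℝ) ≤ √N := Real.le_sqrt_of_sq_le (by norm_num; linarith)
        linarith
      · rw [sub_add_cancel, Real.sq_sqrt (by linarith)]
    refine hG.resolventEnergy_lt_of_bounds hV hN (L := x + 12 / 5 + 3 / 8)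
      (a := x + 12 / 5 - 3 / 4) (B := 2 * ((x + 12 / 5) ^ 2) ^ 2 - 8 * (x + 12 / 5) ^ 2 + 54)
      ?_ ?_ ?_ ?_ ?_ ?_ ?_
    · linarith
    · linarith
    · nlinarith
    · nlinarith
    · linarith
    · rw [← sub_pos]
      ring_nf
      positivity
    · rw [← sub_pos]
      ring_nf
      positivity

end SimpleGraph

/-! ### The resolvent energy of `Y_n` -/

theorem theta221_adj (a b : Fin 4) :
    theta221.Adj a b ↔ a ≠ b ∧ ¬(a = 2 ∧ b = 3) ∧ ¬(a = 3 ∧ b = 2) := by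
  simp only [theta221, SimpleGraph.fromEdgeSet_adj, Set.mem_insert_iff, Set.mem_singleton_iff,
    Sym2.eq_iff]
  revert a b
  decide

theorem graphY_adj_inl_inl (n : ℕ) (a b : Fin 4) :
    (graphY n).Adj (.inl a) (.inl b) ↔ a ≠ b ∧ ¬(a = 2 ∧ b = 3) ∧ ¬(a = 3 ∧ b = 2) :=
  theta221_adj a b

theorem graphY_adj_inl_inr (n : ℕ) (a : Fin 4) (j : Fin (n - 4)) :
    (graphY n).Adj (.inl a) (.inr j) ↔ a = 0 := Iff.rfl

theorem graphY_adj_inr_inl (n : ℕ) (a : Fin 4) (j : Fin (n - 4)) :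
    (graphY n).Adj (.inr j) (.inl a) ↔ a = 0 := Iff.rfl

theorem graphY_adj_inr_inr (n : ℕ) (i j : Fin (n - 4)) :
    ¬ (graphY n).Adj (.inr i) (.inr j) := fun h => h

theorem sum_graphY_adj {n : ℕ} [DecidableRel (graphY n).Adj] (f : Fin 4 ⊕ Fin (n - 4) → ℝ) :
    (∑ y, if (graphY n).Adj (.inl 0) y then f y else 0) =
        f (.inl 1) + f (.inl 2) + f (.inl 3) + ∑ j, f (.inr j) ∧
      (∑ y, if (graphY n).Adj (.inl 1) y then f y else 0) =
        f (.inl 0) + f (.inl 2) + f (.inl 3) ∧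
      (∑ y, if (graphY n).Adj (.inl 2) y then f y else 0) = f (.inl 0) + f (.inl 1) ∧
      (∑ y, if (graphY n).Adj (.inl 3) y then f y else 0) = f (.inl 0) + f (.inl 1) ∧
      ∀ i, (∑ y, if (graphY n).Adj (.inr i) y then f y else 0) = f (.inl 0) := by
  refine ⟨?_, ?_, ?_, ?_, fun i => ?_⟩ <;>
    simp [Fintype.sum_sum_type, Fin.sum_univ_four, graphY_adj_inl_inl, graphY_adj_inl_inr,
      graphY_adj_inr_inl, graphY_adj_inr_inr]

/-- For `l ≠ 0`, eliminating the pendent vertices and the two vertices of degree 2 leaves two linear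
equations in the entries at `0` and `1`. The quintic is their determinant up to sign. -/
theorem graphY_eigenvalue {n : ℕ} (hn : 4 ≤ n) [DecidableRel (graphY n).Adj]
    {l : ℝ} {x : Fin 4 ⊕ Fin (n - 4) → ℝ} (hx : x ≠ 0)
    (h : ((graphY n).adjMatrix ℝ).mulVec x = l • x) :
    l ^ 5 - (n + 1) * l ^ 3 - 4 * l ^ 2 + (2 * n - 8) * l = 0 := by
  have hp : ∀ z, (∑ y, if (graphY n).Adj z y then x y else 0) = l * x z := by
    intro z
    have := congrFun h z
    simpa [Matrix.mulVec, dotProduct, SimpleGraph.adjMatrix_apply] using this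
  obtain ⟨e0, e1, e2, e3, ep⟩ := sum_graphY_adj x
  rw [hp] at e0 e1 e2 e3
  simp only [hp] at ep
  by_cases hl : l = 0
  · simp [hl]
  have hsum : l * ∑ j, x (.inr j) = (n - 4) * x (.inl 0) := by
    rw [Finset.mul_sum, Finset.sum_congr rfl fun j _ => ep j]
    simp [Nat.cast_sub hn]
  have k1 : (l ^ 2 - 2) * x (.inl 1) = (l + 2) * x (.inl 0) := by
    linear_combination l * e1 + e2 + e3
  have k2 : (l ^ 2 + 2 * l) * x (.inl 1) = (l ^ 3 - 2 * l - (n - 4) * l) * x (.inl 0) := by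
    linear_combination (-l ^ 2) * e0 - l * e2 - l * e3 - l * hsum
  have k3 : (l ^ 5 - (n + 1) * l ^ 3 - 4 * l ^ 2 + (2 * n - 8) * l) * x (.inl 0) = 0 := by
    linear_combination (l ^ 2 + 2 * l) * k1 - (l ^ 2 - 2) * k2
  rcases mul_eq_zero.mp k3 with h0 | h0
  · exact h0
  exfalso
  rw [h0] at k1 k2 e2 e3
  have h1 : x (.inl 1) = 0 := by
    -- Otherwise `l ^ 2 = 2` and `l = -2` at once.
    by_contra h1
    have a1 : l ^ 2 - 2 = 0 := by
      have : (l ^ 2 - 2) * x (.inl 1) = 0 := by linarith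
      exact (mul_eq_zero.mp this).resolve_right h1
    have a2 : l * (l + 2) = 0 := by
      have : (l * (l + 2)) * x (.inl 1) = 0 := by linarith
      exact (mul_eq_zero.mp this).resolve_right h1
    have a3 := (mul_eq_zero.mp a2).resolve_left hl
    nlinarith
  have h2 : x (.inl 2) = 0 :=
    (mul_eq_zero.mp (e2.trans (by rw [h1, add_zero]))).resolve_left hl
  have h3 : x (.inl 3) = 0 :=
    (mul_eq_zero.mp (e3.trans (by rw [h1, add_zero]))).resolve_left hl
  apply hx
  ext z
  rcases z with z | j
  · fin_cases z
    · exact h0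
    · exact h1
    · exact h2
    · exact h3
  · exact (mul_eq_zero.mp ((ep j).trans h0)).resolve_left hl

/-- Lower bounds on the cycle counts suffice, since the energy of `Y_n` is only needed from below.
-/
theorem le_card_triangleTuples_graphY (n : ℕ) : 12 ≤ #(graphY n).triangleTuples := by
  let S : Finset (Fin 4 × Fin 4 × Fin 4) := univ.filter fun t =>
    (t.1 ≠ t.2.1 ∧ ¬(t.1 = 2 ∧ t.2.1 = 3) ∧ ¬(t.1 = 3 ∧ t.2.1 = 2)) ∧
    (t.2.1 ≠ t.2.2 ∧ ¬(t.2.1 = 2 ∧ t.2.2 = 3) ∧ ¬(t.2.1 = 3 ∧ t.2.2 = 2)) ∧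
    (t.2.2 ≠ t.1 ∧ ¬(t.2.2 = 2 ∧ t.1 = 3) ∧ ¬(t.2.2 = 3 ∧ t.1 = 2))
  have hS : #S = 12 := by decide
  rw [← hS]
  refine Finset.card_le_card_of_injOn (fun t => (.inl t.1, .inl t.2.1, .inl t.2.2)) ?_ ?_
  · intro t ht
    simpa [S, SimpleGraph.triangleTuples, graphY_adj_inl_inl] using ht
  · rintro ⟨a, b, c⟩ _ ⟨a', b', c'⟩ _ h
    simpa using h

theorem le_card_fourCycleTuples_graphY (n : ℕ) : 8 ≤ #(graphY n).fourCycleTuples := by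
  let S : Finset (Fin 4 × Fin 4 × Fin 4 × Fin 4) := {(0, 2, 1, 3), (2, 1, 3, 0), (1, 3, 0, 2),
    (3, 0, 2, 1), (3, 1, 2, 0), (1, 2, 0, 3), (2, 0, 3, 1), (0, 3, 1, 2)}
  have hS : #S = 8 := by decide
  rw [← hS]
  refine Finset.card_le_card_of_injOn
    (fun t => (.inl t.1, .inl t.2.1, .inl t.2.2.1, .inl t.2.2.2)) ?_ ?_
  · intro t ht
    simp only [S, coe_insert, coe_singleton, Set.mem_insert_iff, Set.mem_singleton_iff] at ht
    rcases ht with rfl | rfl | rfl | rfl | rfl | rfl | rfl | rfl <;>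
      simp [SimpleGraph.fourCycleTuples, graphY_adj_inl_inl]
  · rintro ⟨a, b, c, d⟩ _ ⟨a', b', c', d'⟩ _ h
    simpa using h

theorem SimpleGraph.degree_eq_sum_adj {V : Type*} [Fintype V] (G : SimpleGraph V)
    [DecidableRel G.Adj] (v : V) : (G.degree v : ℝ) = ∑ y, if G.Adj v y then 1 else 0 := by
  rw [Finset.sum_boole, ← card_neighborFinset_eq_degree, neighborFinset_eq_filter]

theorem sum_degree_graphY {n : ℕ} (hn : 4 ≤ n) [DecidableRel (graphY n).Adj] :
    ∑ v, ((graphY n).degree v : ℝ) = 2 * (n + 1) ∧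
      ∑ v, ((graphY n).degree v : ℝ) ^ 2 = n ^ 2 - n + 14 := by
  obtain ⟨e0, e1, e2, e3, ep⟩ := sum_graphY_adj (n := n) fun _ => 1
  simp only [Fintype.sum_sum_type (fun v => ((graphY n).degree v : ℝ)),
    Fintype.sum_sum_type (fun v => ((graphY n).degree v : ℝ) ^ 2), Fin.sum_univ_four]
  simp only [SimpleGraph.degree_eq_sum_adj, e0, e1, e2, e3, ep]
  constructor <;> simp [Nat.cast_sub hn] <;> ring

theorem le_resolventEnergy_graphY {n : ℕ} (hn : 5 ≤ n) :
    2 * (n : ℝ) ^ 3 + 2 * n ^ 2 + 4 * n + 32 ≤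
      ((graphY n).resolventEnergy - 1) * (n * (n ^ 4 - n ^ 3 - n ^ 2 - 2 * n - 8)) := by
  classical
  have hN : (Fintype.card (Fin 4 ⊕ Fin (n - 4)) : ℝ) = n := by
    rw [Fintype.card_sum, Fintype.card_fin, Fintype.card_fin]
    exact_mod_cast (by omega : 4 + (n - 4) = n)
  have h5 : (5 : ℝ) ≤ n := by exact_mod_cast hn
  set l := ((graphY n).isHermitian_adjMatrix ℝ).eigenvalues with hl
  have hw : ∀ i, l i ^ 5 - (n + 1) * l i ^ 3 - 4 * l i ^ 2 + (2 * n - 8) * l i = 0 := by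
    intro i
    obtain ⟨x, hx, h⟩ := ((graphY n).isHermitian_adjMatrix ℝ).exists_eigenvector i
    exact graphY_eigenvalue (by omega) hx h
  obtain ⟨hs1, hs2⟩ := sum_degree_graphY (n := n) (by omega)
  have hne : ∀ i, l i ≠ n := by
    intro i
    have h := (graphY n).eigenvalue_sq_le i
    rw [hs1] at h
    intro h'
    change l i ^ 2 ≤ _ at h
    rw [h'] at h
    nlinarith
  have key := (graphY n).resolventEnergy_mul_quintic hN 0 (-(n + 1)) (-4) (2 * n - 8) hne
  rw [hs1, hs2] at key
  rw [Finset.sum_eq_zero (fun i _ => by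
    rw [div_eq_zero_iff]
    left
    have := hw i
    rw [hl] at this
    linarith)] at key
  have h3 : (12 : ℝ) ≤ #(graphY n).triangleTuples := by
    exact_mod_cast le_card_triangleTuples_graphY n
  have h4 : (8 : ℝ) ≤ #(graphY n).fourCycleTuples := by
    exact_mod_cast le_card_fourCycleTuples_graphY n
  have h3' := mul_le_mul_of_nonneg_left h3 (by linarith : (0 : ℝ) ≤ n)
  linarith

/-! ### Graphs with a dominating vertex -/

namespace SimpleGraph

variable {V : Type*} [Fintype V] {G : SimpleGraph V}

/-- A bicyclic graph with a dominating vertex `v` has exactly two edges that avoid `v`. -/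
theorem IsBicyclic.exists_adj_iff_of_degree [DecidableRel G.Adj] (hG : G.IsBicyclic) {v : V}
    (hv : Fintype.card V ≤ G.degree v + 1) :
    ∃ a b c d : V, a ≠ v ∧ b ≠ v ∧ c ≠ v ∧ d ≠ v ∧ a ≠ b ∧ c ≠ d ∧ s(a, b) ≠ s(c, d) ∧
      ∀ x y, G.Adj x y ↔ x ≠ y ∧ (x = v ∨ y = v ∨ s(x, y) = s(a, b) ∨ s(x, y) = s(c, d)) := by
  classical
  have hdeg : G.degree v + 1 = Fintype.card V := by
    have := G.degree_lt_card_verts v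
    omega
  have hadj : ∀ y, y ≠ v → G.Adj v y := by
    have h : G.neighborFinset v = univ.erase v := by
      refine Finset.eq_of_subset_of_card_le ?_ ?_
      · intro y hy
        simpa using ((G.mem_neighborFinset _ _).mp hy).ne'
      · rw [Finset.card_erase_of_mem (mem_univ v), card_neighborFinset_eq_degree, Finset.card_univ]
        omega
    intro y hy
    rw [← mem_neighborFinset, h]
    simpa using hy
  have hcard : #(G.edgeFinset \ G.incidenceFinset v) = 2 := by
    rw [Finset.card_sdiff_of_subset (G.incidenceFinset_subset v), hG.card_edgeFinset,
      card_incidenceFinset_eq_degree]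
    omega
  obtain ⟨e, f, hef, hE⟩ := Finset.card_eq_two.mp hcard
  have hmem : ∀ x y, x ≠ v → y ≠ v → (G.Adj x y ↔ s(x, y) = e ∨ s(x, y) = f) := by
    intro x y hx hy
    have : s(x, y) ∈ G.edgeFinset \ G.incidenceFinset v ↔ s(x, y) = e ∨ s(x, y) = f := by
      rw [hE]
      simp
    rw [← this]
    simp [incidenceSet, hx.symm, hy.symm]
  have he : e ∈ G.edgeFinset \ G.incidenceFinset v := by rw [hE]; simp
  have hf : f ∈ G.edgeFinset \ G.incidenceFinset v := by rw [hE]; simp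
  induction e using Sym2.ind with | _ a b => ?_
  induction f using Sym2.ind with | _ c d => ?_
  simp only [mem_sdiff, mem_edgeFinset, mem_edgeSet, mem_incidenceFinset, incidenceSet,
    Set.mem_sep_iff, Sym2.mem_iff, not_and, not_or] at he hf
  obtain ⟨hva, hvb⟩ := he.2 he.1
  obtain ⟨hvc, hvd⟩ := hf.2 hf.1
  refine ⟨a, b, c, d, Ne.symm hva, Ne.symm hvb, Ne.symm hvc, Ne.symm hvd, he.1.ne, hf.1.ne, hef,
    fun x y => ?_⟩
  by_cases hx : x = v
  · subst hx
    exact ⟨fun h => ⟨h.ne, Or.inl rfl⟩, fun h => hadj y h.1.symm⟩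
  by_cases hy : y = v
  · subst hy
    exact ⟨fun h => ⟨h.ne, Or.inr (Or.inl rfl)⟩, fun h => (hadj x h.1).symm⟩
  rw [hmem x y hx hy]
  constructor
  · intro h
    exact ⟨((hmem x y hx hy).mpr h).ne, Or.inr (Or.inr h)⟩
  · rintro ⟨-, h | h | h⟩
    · exact absurd h hx
    · exact absurd h hy
    · exact h

theorem nonempty_iso_graphY_of_adj_iff {n : ℕ} (hcard : Fintype.card V = n)
    {v a b c : V} (hav : a ≠ v) (hbv : b ≠ v) (hcv : c ≠ v) (hab : a ≠ b) (hbc : b ≠ c)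
    (hac : a ≠ c)
    (hadj : ∀ x y, G.Adj x y ↔
      x ≠ y ∧ (x = v ∨ y = v ∨ s(x, y) = s(a, b) ∨ s(x, y) = s(b, c))) :
    Nonempty (G ≃g graphY n) := by
  classical
  -- The dominating vertex goes to `0`, the common endpoint `b` of the two other edges to `1`, and
  -- the non-adjacent pair `a`, `c` to `2`, `3`.
  let f : Fin 4 → V := ![v, b, a, c]
  have hf : Function.Injective f := by
    intro i j h
    fin_cases i <;> fin_cases j <;> simp_all [f]
  have hc : Fintype.card (Fin (n - 4)) = Fintype.card ↥(Set.range f)ᶜ := by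
    rw [Fintype.card_compl_set, Set.card_range_of_injective hf, hcard]
    simp
  let g : Fin (n - 4) ≃ ↥(Set.range f)ᶜ := Fintype.equivOfCardEq hc
  let e : Fin 4 ⊕ Fin (n - 4) ≃ V :=
    ((Equiv.ofInjective f hf).sumCongr g).trans (Equiv.Set.sumCompl (Set.range f))
  have hel : ∀ i, e (.inl i) = f i := fun i => by simp [e]
  have her : ∀ j, e (.inr j) ≠ v ∧ e (.inr j) ≠ a ∧ e (.inr j) ≠ b ∧ e (.inr j) ≠ c := by
    intro j
    have h1 : e (.inr j) = g j := by simp [e]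
    have h2 : ∀ i, f i ≠ e (.inr j) := fun i h => (g j).2 ⟨i, h.trans h1⟩
    exact ⟨(h2 0).symm, (h2 2).symm, (h2 1).symm, (h2 3).symm⟩
  refine ⟨RelIso.symm ⟨e, ?_⟩⟩
  rintro (i | i) (j | j)
  · rw [hel, hel, hadj, graphY_adj_inl_inl]
    fin_cases i <;> fin_cases j <;>
      simp [f, hav, hbv, hcv, hab, hbc, hac, hav.symm, hbv.symm, hcv.symm, hab.symm, hbc.symm,
        hac.symm]
  · obtain ⟨k1, k2, k3, k4⟩ := her j
    rw [hel, hadj, graphY_adj_inl_inr]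
    fin_cases i <;> simp [f, hbv, hav, hcv, k1, k2, k3, k4, k1.symm, k2.symm, k3.symm, k4.symm]
  · obtain ⟨k1, k2, k3, k4⟩ := her i
    rw [hel, hadj, graphY_adj_inr_inl]
    fin_cases j <;> simp [f, hbv, hav, hcv, k1, k2, k3, k4]
  · obtain ⟨k1, k2, k3, k4⟩ := her i
    obtain ⟨m1, m2, m3, m4⟩ := her j
    rw [hadj]
    simp [k1, k2, k3, k4, m1, m2, m3, m4, graphY_adj_inr_inr]

section Butterfly

variable [DecidableEq V] [DecidableRel G.Adj] {v a b c d : V}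

theorem neighborFinset_of_adj_iff (hav : a ≠ v) (hbv : b ≠ v) (hcv : c ≠ v) (hdv : d ≠ v)
    (hab : a ≠ b) (hcd : c ≠ d) (hac : a ≠ c) (had : a ≠ d) (hbc : b ≠ c) (hbd : b ≠ d)
    (hadj : ∀ x y, G.Adj x y ↔
      x ≠ y ∧ (x = v ∨ y = v ∨ s(x, y) = s(a, b) ∨ s(x, y) = s(c, d))) :
    G.neighborFinset v = univ.erase v ∧ G.neighborFinset a = {v, b} ∧
      G.neighborFinset b = {v, a} ∧ G.neighborFinset c = {v, d} ∧ G.neighborFinset d = {v, c} ∧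
      ∀ z, z ∉ ({v, a, b, c, d} : Finset V) → G.neighborFinset z = {v} := by
  refine ⟨?_, ?_, ?_, ?_, ?_, fun z hz => ?_⟩
  · ext y
    simp [hadj, eq_comm]
  all_goals
    ext y
    simp only [mem_neighborFinset, hadj, Sym2.eq_iff, mem_insert, mem_singleton] at *
    grind

/-- The quintic is `l (l + 1) (l^3 - l^2 - (N - 1) l + (N - 5))` with `N` the number of vertices,
and it vanishes at every eigenvalue except possibly `1`, where its value is `-8`. Away from `0` and
`±1` an eigenvector is constant on `{a, b}` and on `{c, d}`, and it is determined by its entry at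
`v`. -/
theorem butterfly_eigenvalue (hav : a ≠ v) (hbv : b ≠ v) (hcv : c ≠ v) (hdv : d ≠ v)
    (hab : a ≠ b) (hcd : c ≠ d) (hac : a ≠ c) (had : a ≠ d) (hbc : b ≠ c) (hbd : b ≠ d)
    (hadj : ∀ x y, G.Adj x y ↔
      x ≠ y ∧ (x = v ∨ y = v ∨ s(x, y) = s(a, b) ∨ s(x, y) = s(c, d)))
    {l : ℝ} {x : V → ℝ} (hx : x ≠ 0) (h : (G.adjMatrix ℝ).mulVec x = l • x) :
    l ^ 5 - Fintype.card V * l ^ 3 - 4 * l ^ 2 + (Fintype.card V - 5) * l ≤ 0 := by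
  obtain ⟨nv, na, nb, nc, nd, nz⟩ :=
    neighborFinset_of_adj_iff hav hbv hcv hdv hab hcd hac had hbc hbd hadj
  have hp : ∀ z, ∑ y ∈ G.neighborFinset z, x y = l * x z := by
    intro z
    have := congrFun h z
    rwa [adjMatrix_mulVec_apply] at this
  have ev := hp v
  have ea := hp a
  have eb := hp b
  have ec := hp c
  have ed := hp d
  rw [na, Finset.sum_pair hbv.symm] at ea
  rw [nb, Finset.sum_pair hav.symm] at eb
  rw [nc, Finset.sum_pair hdv.symm] at ec
  rw [nd, Finset.sum_pair hcv.symm] at ed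
  have ez : ∀ z, z ∉ ({v, a, b, c, d} : Finset V) → x v = l * x z := by
    intro z hz
    rw [← hp z, nz z hz, Finset.sum_singleton]
  by_cases hl0 : l = 0
  · simp [hl0]
  by_cases hl1 : l = 1
  · subst hl1
    linarith
  by_cases hl2 : l = -1
  · subst hl2
    linarith
  have hl2' : l + 1 ≠ 0 := fun h => hl2 (by linarith)
  have hl1' : l - 1 ≠ 0 := sub_ne_zero.mpr hl1
  have hxab : x a = x b := by
    have : (l + 1) * (x a - x b) = 0 := by linear_combination eb - ea
    exact sub_eq_zero.mp ((mul_eq_zero.mp this).resolve_left hl2')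
  have hxcd : x c = x d := by
    have : (l + 1) * (x c - x d) = 0 := by linear_combination ed - ec
    exact sub_eq_zero.mp ((mul_eq_zero.mp this).resolve_left hl2')
  -- The summand vanishes at every pendent vertex, so only `v, a, b, c, d` contribute.
  have hsum : ∑ z, (l * x z - x v) = (l * x v - x v) + (x b + (x a + (x d + x c))) := by
    rw [← Finset.sum_subset (Finset.subset_univ ({v, a, b, c, d} : Finset V))
      (fun z _ hz => by rw [← ez z hz, sub_self])]
    rw [Finset.sum_insert (by simp [hav.symm, hbv.symm, hcv.symm, hdv.symm]),
      Finset.sum_insert (by simp [hab, hac, had]), Finset.sum_insert (by simp [hbc, hbd]),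
      Finset.sum_pair hcd, ← ea, ← eb, ← ec, ← ed]
    ring
  rw [Finset.sum_sub_distrib, ← Finset.mul_sum, Finset.sum_const, nsmul_eq_mul,
    Finset.card_univ, ← Finset.add_sum_erase _ _ (mem_univ v), ← nv, ev] at hsum
  have key : (l ^ 3 - l ^ 2 - (Fintype.card V - 1) * l + (Fintype.card V - 5)) * x v = 0 := by
    linear_combination (l - 1) * hsum + (l - 1) * hxab + (l - 1) * hxcd - 2 * ea - 2 * ec
      - 2 * l * hxab - 2 * l * hxcd
  rcases mul_eq_zero.mp key with hk | hk
  · apply le_of_eq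
    linear_combination l * (l + 1) * hk
  exfalso
  have ha0 : x a = 0 := by
    have : (l - 1) * x a = 0 := by linear_combination hk - ea - hxab
    exact (mul_eq_zero.mp this).resolve_left hl1'
  have hc0 : x c = 0 := by
    have : (l - 1) * x c = 0 := by linear_combination hk - ec - hxcd
    exact (mul_eq_zero.mp this).resolve_left hl1'
  apply hx
  ext z
  by_cases hz : z ∈ ({v, a, b, c, d} : Finset V)
  · simp only [mem_insert, mem_singleton] at hz
    rcases hz with rfl | rfl | rfl | rfl | rfl
    · exact hk
    · exact ha0
    · exact hxab.symm.trans ha0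
    · exact hc0
    · exact hxcd.symm.trans hc0
  · exact (mul_eq_zero.mp ((ez z hz).symm.trans hk)).resolve_left hl0

theorem butterfly_sum_degree_sq (hav : a ≠ v) (hbv : b ≠ v) (hcv : c ≠ v) (hdv : d ≠ v)
    (hab : a ≠ b) (hcd : c ≠ d) (hac : a ≠ c) (had : a ≠ d) (hbc : b ≠ c) (hbd : b ≠ d)
    (hadj : ∀ x y, G.Adj x y ↔
      x ≠ y ∧ (x = v ∨ y = v ∨ s(x, y) = s(a, b) ∨ s(x, y) = s(c, d))) :
    ∑ z, (G.degree z : ℝ) ^ 2 = (Fintype.card V : ℝ) ^ 2 - Fintype.card V + 12 := by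
  obtain ⟨nv, na, nb, nc, nd, nz⟩ :=
    neighborFinset_of_adj_iff hav hbv hcv hdv hab hcd hac had hbc hbd hadj
  have dv : (G.degree v : ℝ) = Fintype.card V - 1 := by
    rw [← card_neighborFinset_eq_degree, nv, Finset.card_erase_of_mem (mem_univ v),
      Finset.card_univ, Nat.cast_sub (Fintype.card_pos_iff.mpr ⟨v⟩), Nat.cast_one]
  have da : G.degree a = 2 := by
    rw [← card_neighborFinset_eq_degree, na, Finset.card_pair hbv.symm]
  have db : G.degree b = 2 := by
    rw [← card_neighborFinset_eq_degree, nb, Finset.card_pair hav.symm]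
  have dc : G.degree c = 2 := by
    rw [← card_neighborFinset_eq_degree, nc, Finset.card_pair hdv.symm]
  have dd : G.degree d = 2 := by
    rw [← card_neighborFinset_eq_degree, nd, Finset.card_pair hcv.symm]
  have hsum : ∑ z, ((G.degree z : ℝ) ^ 2 - 1) = ((Fintype.card V : ℝ) - 1) ^ 2 + 11 := by
    rw [← Finset.sum_subset (Finset.subset_univ ({v, a, b, c, d} : Finset V))
      (fun z _ hz => by
        rw [← card_neighborFinset_eq_degree, nz z hz, Finset.card_singleton]; norm_num)]
    rw [Finset.sum_insert (by simp [hav.symm, hbv.symm, hcv.symm, hdv.symm]),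
      Finset.sum_insert (by simp [hab, hac, had]), Finset.sum_insert (by simp [hbc, hbd]),
      Finset.sum_pair hcd, dv, da, db, dc, dd]
    push_cast
    ring
  rw [Finset.sum_sub_distrib] at hsum
  simp only [sum_const, card_univ, nsmul_eq_mul, mul_one] at hsum
  linarith

end Butterfly

theorem IsBicyclic.butterfly_resolventEnergy_lt [DecidableRel G.Adj] (hG : G.IsBicyclic)
    (hV : 5 ≤ Fintype.card V) {N : ℝ} (hN : (Fintype.card V : ℝ) = N) {v a b c d : V}
    (hav : a ≠ v) (hbv : b ≠ v) (hcv : c ≠ v) (hdv : d ≠ v)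
    (hab : a ≠ b) (hcd : c ≠ d) (hac : a ≠ c) (had : a ≠ d) (hbc : b ≠ c) (hbd : b ≠ d)
    (hadj : ∀ x y, G.Adj x y ↔
      x ≠ y ∧ (x = v ∨ y = v ∨ s(x, y) = s(a, b) ∨ s(x, y) = s(c, d))) :
    (G.resolventEnergy - 1) * (N * (N ^ 4 - N ^ 3 - N ^ 2 - 2 * N - 8)) <
      2 * N ^ 3 + 2 * N ^ 2 + 4 * N + 32 := by
  classical
  have hN5 : 5 ≤ N := by rw [← hN]; exact_mod_cast hV
  have hs := hG.sum_degrees_real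
  have hs2 := butterfly_sum_degree_sq hav hbv hcv hdv hab hcd hac had hbc hbd hadj
  rw [hN] at hs hs2
  have hlt : ∀ i, (G.isHermitian_adjMatrix ℝ).eigenvalues i < N := fun i =>
    hN ▸ hG.eigenvalue_lt_card hV i
  have key := G.resolventEnergy_mul_quintic hN 0 (-N) (-4) (N - 5) (fun i => (hlt i).ne)
  have hneg : ∑ i, ((G.isHermitian_adjMatrix ℝ).eigenvalues i ^ 5 +
        0 * (G.isHermitian_adjMatrix ℝ).eigenvalues i ^ 4 +
        (-N) * (G.isHermitian_adjMatrix ℝ).eigenvalues i ^ 3 +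
        (-4) * (G.isHermitian_adjMatrix ℝ).eigenvalues i ^ 2 +
        (N - 5) * (G.isHermitian_adjMatrix ℝ).eigenvalues i) /
          (N - (G.isHermitian_adjMatrix ℝ).eigenvalues i) ≤ 0 := by
    refine Finset.sum_nonpos fun i _ => ?_
    refine div_nonpos_of_nonpos_of_nonneg ?_ (sub_nonneg.mpr (hlt i).le)
    obtain ⟨x, hx, h⟩ := (G.isHermitian_adjMatrix ℝ).exists_eigenvector i
    have := butterfly_eigenvalue hav hbv hcv hdv hab hcd hac had hbc hbd hadj hx h
    rw [hN] at this
    linarith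
  have h' := hG.mul_card_triangleTuples_add_le (c := N) (by linarith)
  rw [hs, hs2] at key
  -- Shifting by 5 turns the remaining inequalities into polynomials in `x ≥ 0` with visibly
  -- positive values.
  obtain ⟨x, hx, rfl⟩ : ∃ x : ℝ, 0 ≤ x ∧ N = x + 5 := ⟨N - 5, by linarith, by ring⟩
  set E := G.resolventEnergy - 1 with hE
  have hX : E * ((x + 5) * ((x + 5) ^ 4 - (x + 5) ^ 3 - 3 * (x + 5) - 5)) ≤
      2 * (x + 5) ^ 3 + 2 * (x + 5) ^ 2 + 6 * (x + 5) + 30 := by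
    rw [hE]
    linarith
  have hD : 0 < (x + 5) ^ 4 - (x + 5) ^ 3 - (x + 5) ^ 2 - 2 * (x + 5) - 8 := by
    ring_nf
    positivity
  have hW : 0 < (x + 5) ^ 4 - (x + 5) ^ 3 - 3 * (x + 5) - 5 := by
    ring_nf
    positivity
  have hfin : ((x + 5) ^ 4 - (x + 5) ^ 3 - (x + 5) ^ 2 - 2 * (x + 5) - 8) *
      (2 * (x + 5) ^ 3 + 2 * (x + 5) ^ 2 + 6 * (x + 5) + 30) <
      (2 * (x + 5) ^ 3 + 2 * (x + 5) ^ 2 + 4 * (x + 5) + 32) *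
        ((x + 5) ^ 4 - (x + 5) ^ 3 - 3 * (x + 5) - 5) := by
    rw [← sub_pos]
    ring_nf
    positivity
  refine lt_of_mul_lt_mul_right (a := (x + 5) ^ 4 - (x + 5) ^ 3 - 3 * (x + 5) - 5) ?_ hW.le
  refine lt_of_le_of_lt ?_ hfin
  refine le_of_eq_of_le ?_ (mul_le_mul_of_nonneg_left hX hD.le)
  ring

/-- A bicyclic graph is isomorphic to `Y_n`, or it satisfies a strict energy bound. -/
theorem IsBicyclic.nonempty_iso_graphY_or_lt (hG : G.IsBicyclic) {n : ℕ} (hn : 5 ≤ n)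
    (hcard : Fintype.card V = n) :
    Nonempty (G ≃g graphY n) ∨
      (G.resolventEnergy - 1) * (n * ((n : ℝ) ^ 4 - n ^ 3 - n ^ 2 - 2 * n - 8)) <
        2 * (n : ℝ) ^ 3 + 2 * n ^ 2 + 4 * n + 32 := by
  classical
  have hV : 5 ≤ Fintype.card V := by omega
  have hN : (Fintype.card V : ℝ) = n := by rw [hcard]
  by_cases hd : ∀ v, G.degree v ≤ Fintype.card V - 2
  · exact Or.inr (hG.resolventEnergy_lt_of_degree_le hV hN hd)
  push Not at hd
  obtain ⟨v, hv⟩ := hd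
  obtain ⟨a, b, c, d, hav, hbv, hcv, hdv, hab, hcd, hne, hadj⟩ :=
    hG.exists_adj_iff_of_degree (v := v) (by omega)
  -- The two edges avoiding `v` can share an endpoint in four ways, each giving `Y_n`; if none
  -- occurs they are disjoint.
  by_cases hac : a = c
  · subst hac
    have hbd : b ≠ d := fun h => hne (by rw [h])
    refine Or.inl (nonempty_iso_graphY_of_adj_iff hcard hbv hav hdv hab.symm hcd hbd ?_)
    simpa only [Sym2.eq_swap (a := b)] using hadj
  by_cases had : a = d
  · subst had
    have hbc : b ≠ c := fun h => hne (by rw [h, Sym2.eq_swap])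
    refine Or.inl (nonempty_iso_graphY_of_adj_iff hcard hbv hav hcv hab.symm hcd.symm
      hbc ?_)
    simpa only [Sym2.eq_swap (a := b), Sym2.eq_swap (a := c)] using hadj
  by_cases hbc : b = c
  · subst hbc
    exact Or.inl (nonempty_iso_graphY_of_adj_iff hcard hav hbv hdv hab hcd had hadj)
  by_cases hbd : b = d
  · subst hbd
    refine Or.inl (nonempty_iso_graphY_of_adj_iff hcard hav hbv hcv hab hcd.symm hac ?_)
    simpa only [Sym2.eq_swap (a := c)] using hadj
  exact Or.inr (hG.butterfly_resolventEnergy_lt hV hN hav hbv hcv hdv hab hcd hac had hbc hbd hadj)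

end SimpleGraph

theorem mainTheorem3 {V : Type*} [Fintype V] (G : SimpleGraph V) (n : ℕ) (hn : 5 ≤ n)
    (hcard : Fintype.card V = n) (hG : G.IsBicyclic) :
    G.resolventEnergy ≤ (graphY n).resolventEnergy ∧
      (G.resolventEnergy = (graphY n).resolventEnergy ↔ Nonempty (G ≃g graphY n)) := by
  rcases hG.nonempty_iso_graphY_or_lt hn hcard with h | h
  · have he : G.resolventEnergy = (graphY n).resolventEnergy := h.some.resolventEnergy_eq
    exact ⟨he.le, fun _ => h, fun _ => he⟩
  · have hlt := h.trans_le (le_resolventEnergy_graphY hn)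
    have hpos : (0 : ℝ) ≤ n * ((n : ℝ) ^ 4 - n ^ 3 - n ^ 2 - 2 * n - 8) := by
      obtain ⟨x, hx, hx'⟩ : ∃ x : ℝ, 0 ≤ x ∧ (n : ℝ) = x + 5 :=
        ⟨n - 5, sub_nonneg.mpr (by exact_mod_cast hn), by ring⟩
      rw [hx']
      ring_nf
      positivity
    have hER : G.resolventEnergy < (graphY n).resolventEnergy := by
      have := lt_of_mul_lt_mul_right hlt hpos
      linarith
    exact ⟨hER.le, fun he => absurd he hER.ne, fun hi => hi.some.resolventEnergy_eq⟩
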